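/- **Diagonal linear nets, rich regime.** Let $n\ge 1$, let $x_1,\dots,x_n\in\mathbb R^d$, let $w^*\in\mathbb R^d$, and let $y_i=\operatorname{sign}(\langle w^*,x_i\rangle)\in\{-1,+1\}$ (so $\langle w^*,x_i\rangle\neq 0$ for all $i$). For $\theta=(u,v)\in\mathbb R^d\times\mathbb R^d\simeq\mathbb R^{2d}$ let $f(\theta;x)=\sum_{j=1}^d u_j^2x_j-\sum_{j=1}^d v_j^2x_j=\langle u^{\odot 2}-v^{\odot 2},x\rangle$ be the two-layer diagonal linear net, and for $\lambda>0$ let $$\mathcal L_\lambda(\theta)=\frac1n\sum_{i=1}^n e^{-y_i f(\theta;x_i)}+\frac{\lambda}{2}\|\theta\|_2^2 .$$ Let the weight decay be a function $\lambda=\lambda(\alpha)>0$ of the initialization scale $\alpha>0$ with $\lambda(\alpha)=\Theta(\alpha^{-p})$ as $\alpha\to+\infty$ for some constant $p>0$. Let $\bar\theta_{\mathrm{init}}=(\mathbf 1,\mathbf 1)$, and let $\theta(t;\alpha\bar\theta_{\mathrm{init}})$, $t\ge 0$, be the solution of the gradient flow $\frac{d\theta}{dt}=-\nabla\mathcal L_{\lambda(\alpha)}(\theta)$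 with $\theta(0)=\alpha\bar\theta_{\mathrm{init}}$. Then for every constant $c\in(0,1)$ and every sequence $\alpha_k\ge 1$ with $\alpha_k\to+\infty$ there exist times $t_k$ with $$\frac{1}{\lambda(\alpha_k)}\log\alpha_k\le t_k\le\frac{1+c}{\lambda(\alpha_k)}\log\alpha_k\qquad\text{for all }k,$$ such that every limit point (limit of a subsequence) of the sequence $\dfrac{\theta(t_k;\alpha_k\bar\theta_{\mathrm{init}})}{\|\theta(t_k;\alpha_k\bar\theta_{\mathrm{init}})\|_2}$ equals $\theta^*/\|\theta^*\|_2$ for some nonzero KKT (Karush–Kuhn–Tucker) point $\theta^*=(u^*,v^*)$ of the problem $$\min_{u,v\in\mathbb R^d}\ \|u\|_2^2+\|v\|_2^2\quad\text{s.t.}\quad y_i\langle u^{\odot 2}-v^{\odot 2},x_i\rangle\ge 1\quad\text{for all } i\in\{1,\dots,n\}.$$ -/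

import Mathlib

open Filter Topology Asymptotics

noncomputable section

namespace DiagNet

/-- The parameter space `ℝ^d × ℝ^d ≃ ℝ^{2d}` with the Euclidean norm; a parameter is
`θ = (u, v)`, where `u k = θ (.inl k)` and `v k = θ (.inr k)`. -/
abbrev Param (d : ℕ) : Type := EuclideanSpace ℝ (Fin d ⊕ Fin d)

variable {d n : ℕ}

/-- The component `u` of `θ = (u, v)`. -/
def uPart (θ : Param d) : EuclideanSpace ℝ (Fin d) := WithLp.toLp 2 fun k => θ (Sum.inl k)

/-- The component `v` of `θ = (u, v)`. -/
def vPart (θ : Param d) : EuclideanSpace ℝ (Fin d) := WithLp.toLp 2 fun k => θ (Sum.inr k)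

/-- The two-layer diagonal linear net `f(θ; x) = ∑ₖ uₖ² xₖ - ∑ₖ vₖ² xₖ`. -/
def net (θ : Param d) (x : EuclideanSpace ℝ (Fin d)) : ℝ :=
  ∑ k, uPart θ k ^ 2 * x k - ∑ k, vPart θ k ^ 2 * x k

/-- The effective weight `w(θ) = u^{⊙2} - v^{⊙2}` (entrywise squares). -/
def effWeight (θ : Param d) : EuclideanSpace ℝ (Fin d) :=
  WithLp.toLp 2 fun k => uPart θ k ^ 2 - vPart θ k ^ 2

theorem net_eq_inner (θ : Param d) (x : EuclideanSpace ℝ (Fin d)) :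
    net θ x = inner ℝ (effWeight θ) x := by
  simp [net, effWeight, PiLp.inner_apply, ← Finset.sum_sub_distrib]
  exact Finset.sum_congr rfl fun k _ => by ring

/-- The empirical exponential loss `(1/n) ∑ᵢ exp (-yᵢ f(θ; xᵢ))`. -/
def loss (x : Fin n → EuclideanSpace ℝ (Fin d)) (y : Fin n → ℝ) (θ : Param d) : ℝ :=
  (1 / (n : ℝ)) * ∑ i, Real.exp (-(y i * net θ (x i)))

/-- The loss with weight decay `lam`. -/
def regLoss (x : Fin n → EuclideanSpace ℝ (Fin d)) (y : Fin n → ℝ) (lam : ℝ) (θ : Param d) : ℝ :=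
  loss x y θ + lam / 2 * ‖θ‖ ^ 2

/-- The unscaled initialization `(𝟏, 𝟏)`. -/
def initParam (d : ℕ) : Param d := WithLp.toLp 2 fun _ => 1

/-- `θ` is a solution on `[0, ∞)` of the gradient flow `dθ/dt = -∇F(θ)` with `θ(0) = θ₀`. -/
def IsGradientFlow {E : Type*} [NormedAddCommGroup E] [InnerProductSpace ℝ E] [CompleteSpace E]
    (F : E → ℝ) (θ₀ : E) (θ : ℝ → E) : Prop :=
  θ 0 = θ₀ ∧ ∀ t, 0 ≤ t → HasDerivWithinAt θ (-gradient F (θ t)) (Set.Ici 0) t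

/-- `z` is a Karush–Kuhn–Tucker point of `min g(z)` subject to `h i z ≥ 1` for all `i`
(for differentiable `g` and `h i`): primal feasibility, and multipliers `μ` satisfying dual
feasibility, complementary slackness and stationarity. -/
def IsKKTPoint {E ι : Type*} [NormedAddCommGroup E] [InnerProductSpace ℝ E] [CompleteSpace E]
    [Fintype ι] (g : E → ℝ) (h : ι → E → ℝ) (z : E) : Prop :=
  (∀ i, 1 ≤ h i z) ∧
    ∃ μ : ι → ℝ, (∀ i, 0 ≤ μ i) ∧ (∀ i, μ i * (h i z - 1) = 0) ∧
      gradient g z = ∑ i, μ i • gradient (h i) z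

end DiagNet

end

/-!
Fix `w` with margin at least `γ > 0` on every sample. Along the flow the mirror potential
`∑ w_k (log u_k - log v_k)` grows at a rate of at least `4 γ` times the exponential loss, while the
identity `u_k v_k exp (2 λ t) = α ^ 2` and the decrease of the objective keep it `O(log α)` at times
`O(log α / λ)`; hence the integrated loss is `O(log α)`. Since the margins are 2-homogeneous, this
bounds the growth of `‖θ‖ ^ 2`, and at time `log α / λ` weight decay has reduced the contribution of
the initialization to `O(1)`. Two applications of the mean value theorem inside the time window,
first to the squared norm and then to the objective, give a time at which the objective is
`O(λ log (1 / λ))` and its gradient `O(λ)`.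

At such times all margins tend to infinity while the normalized margins stay bounded below. The
sample losses divided by `λ` are approximate multipliers, bounded because of Euler's identity, and
in the limit they vanish on every sample whose normalized margin is not minimal. A limit direction,
rescaled to minimal margin one, is therefore a Karush–Kuhn–Tucker point.
-/

noncomputable section

namespace DiagNet

theorem mul_pos_of_eq_sign {a b : ℝ} (ha : a = 1 ∨ a = -1) (hab : a = Real.sign b) :
    0 < a * b := by
  have hb : b ≠ 0 := by
    rintro rfl
    rw [Real.sign_zero] at hab
    rcases ha with rfl | rfl <;> norm_num at hab
  rw [hab]
  exact Real.sign_mul_pos_of_ne_zero b hb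

theorem exists_seq_of_eventually {κ τ : Type*} {l : Filter κ} {Q P : κ → τ → Prop}
    (hQ : ∀ k, ∃ t, Q k t) (hP : ∀ᶠ k in l, ∃ t, Q k t ∧ P k t) :
    ∃ t : κ → τ, (∀ k, Q k (t k)) ∧ ∀ᶠ k in l, P k (t k) := by
  have hchoice : ∀ k, ∃ t, Q k t ∧ ((∃ s, Q k s ∧ P k s) → P k t) := fun k => by
    by_cases hk : ∃ s, Q k s ∧ P k s
    · exact hk.imp fun s hs => ⟨hs.1, fun _ => hs.2⟩
    · exact (hQ k).imp fun s hs => ⟨hs, fun h => absurd h hk⟩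
  choose t ht using hchoice
  exact ⟨t, fun k => (ht k).1, hP.mono fun k hk => (ht k).2 hk⟩

theorem tendsto_neg_log_atTop {κ : Type*} {l : Filter κ} {lam : κ → ℝ} (hlam : ∀ k, 0 < lam k)
    (hlam0 : Tendsto lam l (𝓝 0)) : Tendsto (fun k => -Real.log (lam k)) l atTop :=
  tendsto_neg_atBot_atTop.comp (Real.tendsto_log_nhdsGT_zero.comp
    (tendsto_nhdsWithin_iff.2 ⟨hlam0, Eventually.of_forall hlam⟩))

theorem isBigO_log_of_isTheta_rpow {lam : ℝ → ℝ} {p : ℝ} (hlam_pos : ∀ a, 0 < a → 0 < lam a)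
    (hlam : lam =Θ[atTop] fun a : ℝ => a ^ p) :
    (fun a => Real.log (lam a)) =O[atTop] Real.log := by
  obtain ⟨C, hC, hupper⟩ := hlam.1.exists_pos
  obtain ⟨B, hB, hlower⟩ := hlam.2.exists_pos
  have hbounded : (fun a => Real.log (lam a) - p * Real.log a) =O[atTop] fun _ => (1 : ℝ) := by
    refine IsBigO.of_bound (|Real.log C| + |Real.log B|) ?_
    filter_upwards [hupper.bound, hlower.bound, eventually_gt_atTop 0] with a ha hb ha0
    rw [Real.norm_of_nonneg (hlam_pos a ha0).le, Real.norm_of_nonneg (by positivity)] at ha hb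
    have hlogC := Real.log_le_log (hlam_pos a ha0) ha
    have hlogB := Real.log_le_log (by positivity) hb
    rw [Real.log_mul hC.ne' (by positivity), Real.log_rpow ha0] at hlogC
    rw [Real.log_mul hB.ne' (hlam_pos a ha0).ne', Real.log_rpow ha0] at hlogB
    rw [norm_one, mul_one, Real.norm_eq_abs, abs_le]
    constructor <;> linarith [le_abs_self (Real.log C), le_abs_self (Real.log B),
      abs_nonneg (Real.log C), abs_nonneg (Real.log B)]
  have hsum := (hbounded.trans (Real.isLittleO_const_log_atTop (c := 1)).isBigO).add
    ((isBigO_refl Real.log atTop).const_mul_left p)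
  simpa only [sub_add_cancel] using hsum

theorem exists_hasDerivWithinAt_Ici_eq_slope {f f' : ℝ → ℝ} {s a b : ℝ}
    (hf : ∀ t, s ≤ t → HasDerivWithinAt f (f' t) (Set.Ici s) t) (hs : s ≤ a) (hab : a < b) :
    ∃ t ∈ Set.Ioo a b, f' t = (f b - f a) / (b - a) :=
  exists_hasDerivAt_eq_slope f f' hab
    (fun t ht => (hf t (hs.trans ht.1)).continuousWithinAt.mono fun _ hr => hs.trans hr.1)
    fun t ht => (hf t (hs.trans ht.1.le)).hasDerivAt (Ici_mem_nhds (hs.trans_lt ht.1))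

theorem eventually_mul_mul_exp_neg_le (C : ℝ) :
    ∀ᶠ K : ℝ in atTop, C * (K * Real.exp (-K)) ≤ Real.exp (-(K / 2)) := by
  have hlim := ((Real.tendsto_pow_mul_exp_neg_atTop_nhds_zero 1).comp
    (tendsto_id.atTop_div_const (zero_lt_two (α := ℝ)))).const_mul (2 * C)
  rw [mul_zero] at hlim
  filter_upwards [hlim.eventually_le_const zero_lt_one] with K hK
  simp only [Function.comp_apply, id, pow_one] at hK
  calc C * (K * Real.exp (-K))
      = 2 * C * (K / 2 * Real.exp (-(K / 2))) * Real.exp (-(K / 2)) := by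
        rw [← add_halves (-K), Real.exp_add, neg_div]
        ring
    _ ≤ Real.exp (-(K / 2)) := mul_le_of_le_one_left (Real.exp_pos _).le hK

theorem exp_neg_mul_self_le {K : ℝ} (hK : 1 ≤ K) (q : ℝ) :
    Real.exp (-q) * q ≤ K * (Real.exp (-q) + Real.exp (-K)) := by
  rw [mul_add]
  rcases le_total q K with hqK | hKq
  · have hq : Real.exp (-q) * q ≤ K * Real.exp (-q) := by
      rw [mul_comm]
      gcongr
    have hKpos : 0 < K * Real.exp (-K) := by positivity
    linarith
  · have htail : Real.exp (-(q - K)) * q ≤ K := by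
      rw [Real.exp_neg, inv_mul_le_iff₀ (Real.exp_pos _)]
      nlinarith [Real.add_one_le_exp (q - K)]
    have hq : Real.exp (-q) * q ≤ K * Real.exp (-K) := by
      calc Real.exp (-q) * q = Real.exp (-(q - K)) * q * Real.exp (-K) := by
            rw [mul_right_comm, ← Real.exp_add]
            ring_nf
        _ ≤ K * Real.exp (-K) := by gcongr
    have hKpos : 0 < K * Real.exp (-q) := by positivity
    linarith

section ExpLoss

variable {ι E : Type*} [Fintype ι] {h : ι → E → ℝ}

/-- The contribution of sample `i` to the empirical exponential loss of the margins `h`. Divided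
by the weight decay, these are the approximate Karush–Kuhn–Tucker multipliers. -/
def sampleLoss (h : ι → E → ℝ) (θ : E) (i : ι) : ℝ :=
  1 / (Fintype.card ι : ℝ) * Real.exp (-h i θ)

/-- The empirical exponential loss of a family of margins. -/
def expLoss (h : ι → E → ℝ) (θ : E) : ℝ := ∑ i, sampleLoss h θ i

theorem sampleLoss_nonneg (h : ι → E → ℝ) (θ : E) (i : ι) : 0 ≤ sampleLoss h θ i := by
  unfold sampleLoss
  positivity

theorem expLoss_nonneg (h : ι → E → ℝ) (θ : E) : 0 ≤ expLoss h θ :=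
  Finset.sum_nonneg fun i _ => sampleLoss_nonneg h θ i

theorem sum_one_div_card_mul_le {a : ℝ} (ha : 0 ≤ a) :
    ∑ _i : ι, 1 / (Fintype.card ι : ℝ) * a ≤ a := by
  rw [Finset.sum_const, Finset.card_univ, nsmul_eq_mul, ← mul_assoc, mul_one_div]
  exact mul_le_of_le_one_left ha (div_self_le_one _)

theorem expLoss_le_one {θ : E} (hθ : ∀ i, 0 ≤ h i θ) : expLoss h θ ≤ 1 := by
  refine le_trans (Finset.sum_le_sum fun i _ => ?_) (sum_one_div_card_mul_le (ι := ι) zero_le_one)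
  unfold sampleLoss
  gcongr
  exact Real.exp_le_one_iff.2 (neg_nonpos.2 (hθ i))

theorem exp_neg_le_card_mul_expLoss (h : ι → E → ℝ) (θ : E) (i : ι) :
    Real.exp (-h i θ) ≤ Fintype.card ι * expLoss h θ := by
  have : Nonempty ι := ⟨i⟩
  calc Real.exp (-h i θ) = Fintype.card ι * sampleLoss h θ i := by
        rw [sampleLoss, ← mul_assoc, mul_one_div_cancel (by positivity), one_mul]
    _ ≤ Fintype.card ι * expLoss h θ := by
        gcongr
        exact Finset.single_le_sum (fun j _ => sampleLoss_nonneg h θ j) (Finset.mem_univ i)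

theorem sum_sampleLoss_mul_le {K : ℝ} (hK : 1 ≤ K) (θ : E) :
    ∑ i, sampleLoss h θ i * h i θ ≤ K * (expLoss h θ + Real.exp (-K)) := by
  calc ∑ i, sampleLoss h θ i * h i θ
      ≤ ∑ i, (K * sampleLoss h θ i + 1 / (Fintype.card ι : ℝ) * (K * Real.exp (-K))) := by
        refine Finset.sum_le_sum fun i _ => ?_
        have hi := mul_le_mul_of_nonneg_left (exp_neg_mul_self_le hK (h i θ))
          (by positivity : 0 ≤ 1 / (Fintype.card ι : ℝ))
        unfold sampleLoss
        linarith
    _ ≤ K * (expLoss h θ + Real.exp (-K)) := by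
        rw [Finset.sum_add_distrib, ← Finset.mul_sum, mul_add]
        exact add_le_add_right (sum_one_div_card_mul_le (by positivity)) _

/-- The exponential loss of a family of margins with weight decay `lam`. -/
def regExpLoss [Norm E] (h : ι → E → ℝ) (lam : ℝ) (θ : E) : ℝ := expLoss h θ + lam / 2 * ‖θ‖ ^ 2

theorem regExpLoss_nonneg [SeminormedAddCommGroup E] {lam : ℝ} (h : ι → E → ℝ) (hlam : 0 ≤ lam)
    (θ : E) : 0 ≤ regExpLoss h lam θ :=
  add_nonneg (expLoss_nonneg h θ) (by positivity)

theorem norm_sq_le_of_regExpLoss_le [SeminormedAddCommGroup E] {lam B : ℝ} (hlam : 0 < lam)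
    {θ : E} (hle : regExpLoss h lam θ ≤ lam * B) : ‖θ‖ ^ 2 ≤ 2 * B := by
  unfold regExpLoss at hle
  have hmul : lam * ‖θ‖ ^ 2 ≤ lam * (2 * B) := by linarith [expLoss_nonneg h θ]
  exact le_of_mul_le_mul_left hmul hlam

theorem eventually_neg_log_div_two_le [SeminormedAddCommGroup E] {κ : Type*} {l : Filter κ}
    {lam : κ → ℝ} {ϑ : κ → E} {C : ℝ} (hlam : ∀ k, 0 < lam k)
    (hlog : Tendsto (fun k => -Real.log (lam k)) l atTop)
    (hloss : ∀ᶠ k in l, regExpLoss h (lam k) (ϑ k) ≤ lam k * (C * -Real.log (lam k))) :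
    ∀ᶠ k in l, ∀ i, -Real.log (lam k) / 2 ≤ h i (ϑ k) := by
  filter_upwards [hloss, hlog.eventually (eventually_mul_mul_exp_neg_le (Fintype.card ι * C))]
    with k hk hexp i
  have hreg : 0 ≤ lam k / 2 * ‖ϑ k‖ ^ 2 := by
    have := hlam k
    positivity
  unfold regExpLoss at hk
  rw [neg_neg, Real.exp_log (hlam k)] at hexp
  rw [← neg_le_neg_iff, ← Real.exp_le_exp]
  calc Real.exp (-h i (ϑ k)) ≤ Fintype.card ι * expLoss h (ϑ k) := exp_neg_le_card_mul_expLoss ..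
    _ ≤ Fintype.card ι * (lam k * (C * -Real.log (lam k))) := by
        gcongr
        linarith
    _ = Fintype.card ι * C * (-Real.log (lam k) * lam k) := by ring
    _ ≤ Real.exp (-(-Real.log (lam k) / 2)) := hexp

end ExpLoss

section Normed

variable {E : Type*} [NormedAddCommGroup E] [NormedSpace ℝ E]

/-- Continuously differentiable functions that are homogeneous of degree two, the property of the
margins of the diagonal net that the norm estimates and the limiting argument rely on. -/
structure IsTwoHomogeneous (h : E → ℝ) : Prop where
  contDiff : ContDiff ℝ 1 h
  map_smul : ∀ (a : ℝ) (θ : E), h (a • θ) = a ^ 2 * h θ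

namespace IsTwoHomogeneous

variable {h : E → ℝ}

theorem map_zero (hh : IsTwoHomogeneous h) : h 0 = 0 := by
  simpa using hh.map_smul 0 0

theorem eq_norm_sq_mul (hh : IsTwoHomogeneous h) (θ : E) :
    h θ = ‖θ‖ ^ 2 * h (‖θ‖⁻¹ • θ) := by
  rcases eq_or_ne θ 0 with rfl | hθ
  · simp [hh.map_zero]
  · rw [← hh.map_smul, smul_inv_smul₀ (norm_ne_zero_iff.2 hθ)]

theorem tendsto_norm_atTop {κ : Type*} {l : Filter κ} {ϑ : κ → E} {z : E}
    (hh : IsTwoHomogeneous h) (hmargin : Tendsto (fun k => h (ϑ k)) l atTop)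
    (hz : Tendsto (fun k => ‖ϑ k‖⁻¹ • ϑ k) l (𝓝 z)) : Tendsto (fun k => ‖ϑ k‖) l atTop := by
  have hlim := (hh.contDiff.continuous.tendsto z).comp hz
  have hB : 0 < |h z| + 1 := by positivity
  have hsq : Tendsto (fun k => ‖ϑ k‖ ^ 2) l atTop := by
    refine tendsto_atTop_mono' _ ?_ (hmargin.atTop_div_const hB)
    filter_upwards [hlim.eventually_le_const (show h z < |h z| + 1 by
      linarith [le_abs_self (h z)])] with k hk
    rw [div_le_iff₀ hB, hh.eq_norm_sq_mul (ϑ k)]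
    exact mul_le_mul_of_nonneg_left hk (sq_nonneg _)
  refine (Real.tendsto_sqrt_atTop.comp hsq).congr fun k => Real.sqrt_sq (norm_nonneg _)

end IsTwoHomogeneous

variable {ι : Type*} [Fintype ι] {h : ι → E → ℝ}

theorem eventually_pos_le_margin_direction [Nonempty ι] {κ : Type*} {l : Filter κ} {lam : κ → ℝ}
    {ϑ : κ → E} {C : ℝ} (hh : ∀ i, IsTwoHomogeneous (h i)) (hC : 0 < C) (hlam : ∀ k, 0 < lam k)
    (hlog : Tendsto (fun k => -Real.log (lam k)) l atTop)
    (hloss : ∀ᶠ k in l, regExpLoss h (lam k) (ϑ k) ≤ lam k * (C * -Real.log (lam k))) :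
    ∀ᶠ k in l, ϑ k ≠ 0 ∧ ∀ i, (4 * C)⁻¹ ≤ h i (‖ϑ k‖⁻¹ • ϑ k) := by
  filter_upwards [hloss, hlog.eventually_gt_atTop 0, eventually_neg_log_div_two_le hlam hlog hloss]
    with k hk hpos hmargin
  have hne : ϑ k ≠ 0 := by
    intro hzero
    have i := Classical.arbitrary ι
    have hi := hmargin i
    rw [hzero, (hh i).map_zero] at hi
    linarith
  refine ⟨hne, fun i => ?_⟩
  have hnorm := norm_sq_le_of_regExpLoss_le (hlam k) hk
  have hnormpos : 0 < ‖ϑ k‖ ^ 2 := by positivity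
  refine le_of_mul_le_mul_left ?_ hnormpos
  rw [← (hh i).eq_norm_sq_mul, ← div_eq_mul_inv, div_le_iff₀ (by positivity)]
  nlinarith [hmargin i]

theorem multiplier_eq_zero_of_lt {κ : Type*} {l : Filter κ} [l.NeBot] {lam : κ → ℝ} {ϑ : κ → E}
    {z : E} {μ : ι → ℝ} (hh : ∀ i, IsTwoHomogeneous (h i))
    (hnorm : Tendsto (fun k => ‖ϑ k‖) l atTop) (hz : Tendsto (fun k => ‖ϑ k‖⁻¹ • ϑ k) l (𝓝 z))
    (hμ : ∀ i, Tendsto (fun k => sampleLoss h (ϑ k) i / lam k) l (𝓝 (μ i))) {i j : ι}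
    (hij : h j z < h i z) : μ i = 0 := by
  have hlim : ∀ i, Tendsto (fun k => h i (‖ϑ k‖⁻¹ • ϑ k)) l (𝓝 (h i z)) := fun i =>
    ((hh i).contDiff.continuous.tendsto z).comp hz
  have hexp := Real.tendsto_exp_neg_atTop_nhds_zero.comp (((hlim i).sub (hlim j)).pos_mul_atTop
    (sub_pos.2 hij) ((tendsto_pow_atTop two_ne_zero).comp hnorm))
  rw [← mul_zero (μ j)]
  refine tendsto_nhds_unique (hμ i) (((hμ j).mul hexp).congr fun k => ?_)
  simp only [Function.comp_apply, sampleLoss]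
  rw [(hh i).eq_norm_sq_mul (ϑ k), (hh j).eq_norm_sq_mul (ϑ k), div_mul_eq_mul_div, mul_assoc,
    ← Real.exp_add]
  ring_nf

end Normed

variable {E : Type*} [NormedAddCommGroup E] [InnerProductSpace ℝ E] [CompleteSpace E]

namespace IsTwoHomogeneous

variable {h : E → ℝ}

theorem hasGradientAt (hh : IsTwoHomogeneous h) (θ : E) : HasGradientAt h (gradient h θ) θ :=
  (hh.contDiff.differentiable one_ne_zero θ).hasGradientAt

theorem continuous_gradient (hh : IsTwoHomogeneous h) : Continuous (gradient h) :=
  (InnerProductSpace.toDual ℝ E).symm.continuous.comp (hh.contDiff.continuous_fderiv one_ne_zero)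

theorem gradient_smul (hh : IsTwoHomogeneous h) {a : ℝ} (ha : a ≠ 0) (θ : E) :
    gradient h (a • θ) = a • gradient h θ := by
  have hfderiv : a • fderiv ℝ h (a • θ) = a • a • fderiv ℝ h θ := by
    rw [← fderiv_comp_smul, smul_smul, ← sq, ← fderiv_const_smul
      (hh.contDiff.differentiable one_ne_zero θ)]
    congr 1
    exact funext (hh.map_smul a)
  rw [gradient, smul_right_injective _ ha hfderiv, _root_.map_smul]
  rfl

/-- Euler's identity. -/
theorem inner_gradient_self (hh : IsTwoHomogeneous h) (θ : E) :
    inner ℝ (gradient h θ) θ = 2 * h θ := by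
  have hray : HasDerivAt (fun a : ℝ => a • θ) θ 1 := by
    simpa using (hasDerivAt_id (1 : ℝ)).smul_const θ
  have hleft : HasDerivAt (fun a : ℝ => h (a • θ)) (inner ℝ (gradient h θ) θ) 1 := by
    have hgrad := (hh.hasGradientAt ((1 : ℝ) • θ)).hasFDerivAt.comp_hasDerivAt 1 hray
    rwa [one_smul] at hgrad
  have hright : HasDerivAt (fun a : ℝ => h (a • θ)) (2 * h θ) 1 := by
    simpa [hh.map_smul] using ((hasDerivAt_id (1 : ℝ)).pow 2).mul_const (h θ)
  exact hleft.unique hright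

end IsTwoHomogeneous

variable {ι : Type*} [Fintype ι] {h : ι → E → ℝ} {lam : ℝ}

theorem hasGradientAt_norm_sq (θ : E) : HasGradientAt (fun ϑ : E => ‖ϑ‖ ^ 2) ((2 : ℝ) • θ) θ := by
  rw [hasGradientAt_iff_hasFDerivAt, map_smul, ofNat_smul_eq_nsmul]
  exact (hasStrictFDerivAt_norm_sq θ).hasFDerivAt

namespace IsGradientFlow

variable {F g : E → ℝ} {θ₀ : E} {θ : ℝ → E} {a b t : ℝ}

theorem hasDerivWithinAt_comp (hθ : IsGradientFlow F θ₀ θ) {g' : E} (ht : 0 ≤ t)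
    (hg : HasGradientAt g g' (θ t)) :
    HasDerivWithinAt (fun t => g (θ t)) (-inner ℝ g' (gradient F (θ t))) (Set.Ici 0) t := by
  rw [← inner_neg_right]
  exact hg.hasFDerivAt.comp_hasDerivWithinAt t (hθ.2 t ht)

theorem hasDerivWithinAt_objective (hθ : IsGradientFlow F θ₀ θ) (hF : Differentiable ℝ F)
    (ht : 0 ≤ t) :
    HasDerivWithinAt (fun t => F (θ t)) (-‖gradient F (θ t)‖ ^ 2) (Set.Ici 0) t := by
  rw [← real_inner_self_eq_norm_sq]
  exact hθ.hasDerivWithinAt_comp ht (hF _).hasGradientAt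

theorem antitoneOn_objective (hθ : IsGradientFlow F θ₀ θ) (hF : Differentiable ℝ F) :
    AntitoneOn (fun t => F (θ t)) (Set.Ici 0) :=
  antitoneOn_of_hasDerivWithinAt_nonpos (convex_Ici 0)
    (fun _ ht => (hθ.hasDerivWithinAt_objective hF ht).continuousWithinAt)
    (fun _ ht => (hθ.hasDerivWithinAt_objective hF (interior_subset ht)).mono interior_subset)
    fun _ _ => neg_nonpos.2 (sq_nonneg _)

theorem exists_norm_gradient_sq_le (hθ : IsGradientFlow F θ₀ θ) (hF : Differentiable ℝ F)
    (hF0 : ∀ ϑ, 0 ≤ F ϑ) (ha : 0 ≤ a) (hab : a < b) :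
    ∃ t ∈ Set.Ioo a b, ‖gradient F (θ t)‖ ^ 2 ≤ F (θ a) / (b - a) := by
  obtain ⟨t, ht, hslope⟩ := exists_hasDerivWithinAt_Ici_eq_slope
    (fun _ => hθ.hasDerivWithinAt_objective hF) ha hab
  refine ⟨t, ht, ?_⟩
  rw [← neg_neg (‖_‖ ^ 2), hslope, ← neg_div, neg_sub]
  have : 0 < b - a := sub_pos.2 hab
  gcongr
  linarith [hF0 (θ b)]

end IsGradientFlow

theorem hasGradientAt_regExpLoss {θ : E} (hh : ∀ i, DifferentiableAt ℝ (h i) θ) (lam : ℝ) :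
    HasGradientAt (regExpLoss h lam) (lam • θ - ∑ i, sampleLoss h θ i • gradient (h i) θ) θ := by
  have hloss : HasFDerivAt (expLoss h) (∑ i, -(sampleLoss h θ i • fderiv ℝ (h i) θ)) θ := by
    refine HasFDerivAt.fun_sum fun i _ => ?_
    refine ((hh i).hasFDerivAt.neg.exp.const_mul (1 / (Fintype.card ι : ℝ))).congr_fderiv ?_
    rw [smul_neg, smul_neg, smul_smul]
    rfl
  rw [hasGradientAt_iff_hasFDerivAt]
  refine (hloss.add ((hasGradientAt_norm_sq θ).hasFDerivAt.const_mul (lam / 2))).congr_fderiv ?_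
  simp only [map_sub, map_sum, map_smul, toDual_gradient, Finset.sum_neg_distrib]
  module

theorem differentiable_regExpLoss (hh : ∀ i, IsTwoHomogeneous (h i)) (lam : ℝ) :
    Differentiable ℝ (regExpLoss h lam) := fun _ =>
  (hasGradientAt_regExpLoss
    (fun i => (hh i).contDiff.differentiable one_ne_zero _) lam).differentiableAt

theorem gradient_regExpLoss (hh : ∀ i, IsTwoHomogeneous (h i)) (lam : ℝ) (θ : E) :
    gradient (regExpLoss h lam) θ = lam • θ - ∑ i, sampleLoss h θ i • gradient (h i) θ :=
  (hasGradientAt_regExpLoss (fun i => (hh i).contDiff.differentiable one_ne_zero _) lam).gradient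

theorem inner_self_gradient_regExpLoss (hh : ∀ i, IsTwoHomogeneous (h i)) (lam : ℝ) (θ : E) :
    inner ℝ θ (gradient (regExpLoss h lam) θ) =
      lam * ‖θ‖ ^ 2 - 2 * ∑ i, sampleLoss h θ i * h i θ := by
  rw [gradient_regExpLoss hh, inner_sub_right, real_inner_smul_right, real_inner_self_eq_norm_sq,
    inner_sum, Finset.mul_sum]
  congr 1
  refine Finset.sum_congr rfl fun i _ => ?_
  rw [real_inner_smul_right, real_inner_comm, (hh i).inner_gradient_self]
  ring

namespace IsGradientFlow

variable {θ₀ : E} {θ : ℝ → E} {φ φ' : ℝ → ℝ} {K T a b b' t M : ℝ}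

theorem hasDerivWithinAt_norm_sq (hθ : IsGradientFlow (regExpLoss h lam) θ₀ θ)
    (hh : ∀ i, IsTwoHomogeneous (h i)) (ht : 0 ≤ t) :
    HasDerivWithinAt (fun t => ‖θ t‖ ^ 2)
      (4 * ∑ i, sampleLoss h (θ t) i * h i (θ t) - 2 * lam * ‖θ t‖ ^ 2) (Set.Ici 0) t := by
  convert hθ.hasDerivWithinAt_comp ht (hasGradientAt_norm_sq (θ t)) using 1
  rw [real_inner_smul_left, inner_self_gradient_regExpLoss hh]
  ring

theorem hasDerivWithinAt_exp_mul_norm_sq (hθ : IsGradientFlow (regExpLoss h lam) θ₀ θ)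
    (hh : ∀ i, IsTwoHomogeneous (h i)) (T : ℝ) (ht : 0 ≤ t) :
    HasDerivWithinAt (fun t => Real.exp (2 * lam * (t - T)) * ‖θ t‖ ^ 2)
      (4 * (Real.exp (2 * lam * (t - T)) * ∑ i, sampleLoss h (θ t) i * h i (θ t)))
      (Set.Ici 0) t := by
  refine ((((hasDerivAt_id t).sub_const T).const_mul (2 * lam)).exp.hasDerivWithinAt.mul
    (hθ.hasDerivWithinAt_norm_sq hh ht)).congr_deriv ?_
  simp only [id]
  ring

theorem norm_sq_le (hθ : IsGradientFlow (regExpLoss h lam) θ₀ θ)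
    (hh : ∀ i, IsTwoHomogeneous (h i)) (hlam : 0 ≤ lam) (hK : 1 ≤ K)
    (hφ : ∀ t, 0 ≤ t → HasDerivWithinAt φ (φ' t) (Set.Ici 0) t)
    (hφL : ∀ t, 0 ≤ t → expLoss h (θ t) ≤ φ' t) (hT : 0 ≤ T) :
    ‖θ T‖ ^ 2 ≤ Real.exp (-(2 * lam * T)) * ‖θ₀‖ ^ 2
      + 4 * K * (φ T - φ 0) + 4 * (K * Real.exp (-K)) * T := by
  have hderiv := fun t (ht : 0 ≤ t) => (hθ.hasDerivWithinAt_exp_mul_norm_sq hh T ht).sub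
    (((hφ t ht).const_mul (4 * K)).add
      ((hasDerivWithinAt_id t _).const_mul (4 * (K * Real.exp (-K)))))
  have hanti := antitoneOn_of_hasDerivWithinAt_nonpos (convex_Icc 0 T)
    (fun t ht => (hderiv t ht.1).continuousWithinAt.mono Set.Icc_subset_Ici_self)
    (fun t ht => (hderiv t (interior_subset ht).1).mono fun _ hr => (interior_subset hr).1)
    fun t ht => ?_
  · have hle := hanti ⟨le_rfl, hT⟩ ⟨hT, le_rfl⟩ hT
    simp only [Pi.sub_apply, Pi.add_apply, id, sub_self, mul_zero, Real.exp_zero, one_mul,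
      zero_sub, mul_neg, hθ.1] at hle
    linarith
  obtain ⟨ht0, htT⟩ := interior_subset ht
  have hexp : Real.exp (2 * lam * (t - T)) ≤ 1 :=
    Real.exp_le_one_iff.2 (mul_nonpos_of_nonneg_of_nonpos (by positivity) (sub_nonpos.2 htT))
  have hnonneg : 0 ≤ K * (expLoss h (θ t) + Real.exp (-K)) := by
    have := expLoss_nonneg h (θ t)
    positivity
  have hdamp : Real.exp (2 * lam * (t - T)) * ∑ i, sampleLoss h (θ t) i * h i (θ t) ≤
      K * (expLoss h (θ t) + Real.exp (-K)) :=
    (mul_le_mul_of_nonneg_left (sum_sampleLoss_mul_le hK _) (Real.exp_pos _).le).trans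
      (mul_le_of_le_one_left hnonneg hexp)
  linarith [mul_le_mul_of_nonneg_left (hφL t ht0) (zero_le_one.trans hK)]

theorem exists_energy_le (hθ : IsGradientFlow (regExpLoss h lam) θ₀ θ)
    (hh : ∀ i, IsTwoHomogeneous (h i)) (hlam : 0 ≤ lam) (hK : 1 ≤ K)
    (hφ : ∀ t, 0 ≤ t → HasDerivWithinAt φ (φ' t) (Set.Ici 0) t)
    (hφL : ∀ t, 0 ≤ t → expLoss h (θ t) ≤ φ' t) (ha : 0 ≤ a) (hab : a < b) :
    ∃ t ∈ Set.Ioo a b, 2 * regExpLoss h lam (θ t) ≤ 2 * K * Real.exp (-K) +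
      (Real.exp (-(2 * lam * a)) * ‖θ₀‖ ^ 2 / 2 + 4 * K * (φ b - φ 0)
        + 2 * (K * Real.exp (-K)) * a) / (b - a) := by
  -- Subtracting `8 * K * φ` absorbs the loss terms of the derivative of `‖θ‖ ^ 2` twice over, so
  -- the mean slope of the difference controls the weight decay and the loss together.
  obtain ⟨t, ht, hslope⟩ := exists_hasDerivWithinAt_Ici_eq_slope
    (fun t ht => (hθ.hasDerivWithinAt_norm_sq hh ht).sub ((hφ t ht).const_mul (8 * K))) ha hab
  have ht0 : 0 ≤ t := ha.trans ht.1.le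
  refine ⟨t, ht, ?_⟩
  have hφmono : MonotoneOn φ (Set.Ici 0) :=
    monotoneOn_of_hasDerivWithinAt_nonneg (convex_Ici 0)
      (fun s hs => (hφ s hs).continuousWithinAt)
      (fun s hs => (hφ s (interior_subset hs)).mono interior_subset)
      fun s hs => (expLoss_nonneg h (θ s)).trans (hφL s (interior_subset hs))
  have hφa : 0 ≤ K * (φ a - φ 0) :=
    mul_nonneg (zero_le_one.trans hK) (sub_nonneg.2 (hφmono Set.self_mem_Ici ha ha))
  have hdrop : (‖θ a‖ ^ 2 + 8 * K * (φ b - φ a)) / (b - a) ≤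
      2 * ((Real.exp (-(2 * lam * a)) * ‖θ₀‖ ^ 2 / 2 + 4 * K * (φ b - φ 0)
        + 2 * (K * Real.exp (-K)) * a) / (b - a)) := by
    rw [← mul_div_assoc]
    have : 0 < b - a := sub_pos.2 hab
    gcongr
    linarith [hθ.norm_sq_le hh hlam hK hφ hφL ha]
  have hslope' : -(‖θ a‖ ^ 2 + 8 * K * (φ b - φ a)) / (b - a) ≤
      4 * ∑ i, sampleLoss h (θ t) i * h i (θ t) - 2 * lam * ‖θ t‖ ^ 2 - 8 * K * φ' t := by
    rw [hslope]
    have : 0 < b - a := sub_pos.2 hab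
    gcongr
    simp only [Pi.sub_apply]
    linarith [sq_nonneg ‖θ b‖]
  have hsum := sum_sampleLoss_mul_le (h := h) hK (θ t)
  have hL := mul_le_mul_of_nonneg_left (hφL t ht0) (zero_le_one.trans hK)
  have hKL := mul_le_mul_of_nonneg_right hK (expLoss_nonneg h (θ t))
  rw [neg_div] at hslope'
  unfold regExpLoss
  linarith

theorem exists_near_stationary (hθ : IsGradientFlow (regExpLoss h lam) θ₀ θ)
    (hh : ∀ i, IsTwoHomogeneous (h i)) (hlam : 0 ≤ lam) (hK : 1 ≤ K)
    (hφ : ∀ t, 0 ≤ t → HasDerivWithinAt φ (φ' t) (Set.Ici 0) t)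
    (hφL : ∀ t, 0 ≤ t → expLoss h (θ t) ≤ φ' t) (ha : 0 ≤ a) (hab : a < b) (hbb' : b < b')
    (hM : 2 * K * Real.exp (-K) + (Real.exp (-(2 * lam * a)) * ‖θ₀‖ ^ 2 / 2
      + 4 * K * (φ b - φ 0) + 2 * (K * Real.exp (-K)) * a) / (b - a) ≤ 2 * M) :
    ∃ t ∈ Set.Icc a b', regExpLoss h lam (θ t) ≤ M ∧
      ‖gradient (regExpLoss h lam) (θ t)‖ ^ 2 ≤ M / (b' - b) := by
  have hdiff := differentiable_regExpLoss hh lam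
  obtain ⟨s, ⟨has, hsb⟩, hs⟩ := hθ.exists_energy_le hh hlam hK hφ hφL ha hab
  have hs0 : 0 ≤ s := ha.trans has.le
  have hb0 : 0 ≤ b := hs0.trans hsb.le
  have hanti := hθ.antitoneOn_objective hdiff
  have hb : regExpLoss h lam (θ b) ≤ M := (hanti hs0 hb0 hsb.le).trans (by linarith)
  obtain ⟨t, ⟨hbt, htb'⟩, ht⟩ :=
    hθ.exists_norm_gradient_sq_le hdiff (regExpLoss_nonneg h hlam) hb0 hbb'
  refine ⟨t, ⟨hab.le.trans hbt.le, htb'.le⟩, (hanti hb0 (hb0.trans hbt.le) hbt.le).trans hb,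
    ht.trans ?_⟩
  have : 0 < b' - b := sub_pos.2 hbb'
  gcongr

end IsGradientFlow

theorem isKKTPoint_inv_sqrt_smul (hh : ∀ i, IsTwoHomogeneous (h i)) {z : E} {m : ℝ} {μ : ι → ℝ}
    (hm : 0 < m) (hmin : ∀ i, m ≤ h i z) (hμ : ∀ i, 0 ≤ μ i)
    (hslack : ∀ i, μ i * (h i z - m) = 0) (hstat : z = ∑ i, μ i • gradient (h i) z) :
    IsKKTPoint (fun ϑ : E => ‖ϑ‖ ^ 2) h ((√m)⁻¹ • z) := by
  have hscale : ∀ i, h i ((√m)⁻¹ • z) = h i z / m := fun i => by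
    rw [(hh i).map_smul, inv_pow, Real.sq_sqrt hm.le, inv_mul_eq_div]
  refine ⟨fun i => ?_, fun i => 2 * μ i, fun i => mul_nonneg zero_le_two (hμ i), fun i => ?_, ?_⟩
  · rw [hscale, one_le_div hm]
    exact hmin i
  · rw [hscale, div_sub_one hm.ne', mul_assoc, ← mul_div_assoc, hslack, zero_div, mul_zero]
  · rw [(hasGradientAt_norm_sq _).gradient]
    conv_lhs => rw [hstat]
    rw [Finset.smul_sum, Finset.smul_sum]
    refine Finset.sum_congr rfl fun i _ => ?_
    rw [(hh i).gradient_smul (inv_ne_zero (Real.sqrt_pos.2 hm).ne')]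
    module

theorem inv_smul_gradient_regExpLoss (hh : ∀ i, IsTwoHomogeneous (h i)) (hlam : lam ≠ 0) {θ : E}
    (hθ : θ ≠ 0) : (lam * ‖θ‖)⁻¹ • gradient (regExpLoss h lam) θ =
      ‖θ‖⁻¹ • θ - ∑ i, (sampleLoss h θ i / lam) • gradient (h i) (‖θ‖⁻¹ • θ) := by
  rw [gradient_regExpLoss hh, smul_sub, smul_smul, mul_inv_rev, inv_mul_cancel_right₀ hlam,
    Finset.smul_sum]
  congr 1
  refine Finset.sum_congr rfl fun i _ => ?_
  rw [(hh i).gradient_smul (inv_ne_zero (norm_ne_zero_iff.2 hθ)), smul_smul, smul_smul]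
  congr 1
  ring

theorem sum_sampleLoss_div_mul_le (hh : ∀ i, IsTwoHomogeneous (h i)) (hlam : lam ≠ 0) {θ : E}
    (hθ : θ ≠ 0) (hres : ‖(lam * ‖θ‖)⁻¹ • gradient (regExpLoss h lam) θ‖ ≤ 1) :
    ∑ i, sampleLoss h θ i / lam * h i (‖θ‖⁻¹ • θ) ≤ 1 := by
  have hunit : ‖‖θ‖⁻¹ • θ‖ = 1 := norm_smul_inv_norm (𝕜 := ℝ) hθ
  have hinner : inner ℝ (‖θ‖⁻¹ • θ) ((lam * ‖θ‖)⁻¹ • gradient (regExpLoss h lam) θ) =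
      1 - 2 * ∑ i, sampleLoss h θ i / lam * h i (‖θ‖⁻¹ • θ) := by
    rw [inv_smul_gradient_regExpLoss hh hlam hθ, inner_sub_right, real_inner_self_eq_norm_sq,
      hunit, one_pow, inner_sum, Finset.mul_sum]
    congr 1
    refine Finset.sum_congr rfl fun i _ => ?_
    rw [real_inner_smul_right, real_inner_comm, (hh i).inner_gradient_self]
    ring
  have habs := abs_real_inner_le_norm (‖θ‖⁻¹ • θ) ((lam * ‖θ‖)⁻¹ • gradient (regExpLoss h lam) θ)
  rw [hunit, one_mul, hinner] at habs
  linarith [neg_le_of_abs_le habs]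

section Limit

variable {κ : Type*} {l : Filter κ} {lam : κ → ℝ} {ϑ : κ → E} {z : E} {C δ : ℝ}

theorem tendsto_inv_smul_gradient_regExpLoss (hlam : ∀ k, 0 < lam k)
    (hgrad : ∀ᶠ k in l, ‖gradient (regExpLoss h (lam k)) (ϑ k)‖ ≤ C * lam k)
    (hnorm : Tendsto (fun k => ‖ϑ k‖) l atTop) :
    Tendsto (fun k => (lam k * ‖ϑ k‖)⁻¹ • gradient (regExpLoss h (lam k)) (ϑ k)) l (𝓝 0) := by
  refine squeeze_zero_norm' ?_ (hnorm.const_div_atTop C)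
  filter_upwards [hgrad, hnorm.eventually_gt_atTop 0] with k hk hpos
  have hlamk := hlam k
  rw [norm_smul, norm_inv, norm_mul, norm_norm, Real.norm_of_nonneg hlamk.le,
    inv_mul_le_iff₀ (by positivity), mul_assoc, mul_div_cancel₀ _ hpos.ne', mul_comm]
  exact hk

theorem exists_tendsto_sampleLoss_div {U : Ultrafilter κ} (hh : ∀ i, IsTwoHomogeneous (h i))
    (hlam : ∀ k, 0 < lam k) (hδ : 0 < δ)
    (hmargin : ∀ᶠ k in U, ϑ k ≠ 0 ∧ ∀ i, δ ≤ h i (‖ϑ k‖⁻¹ • ϑ k))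
    (hres : Tendsto (fun k => (lam k * ‖ϑ k‖)⁻¹ • gradient (regExpLoss h (lam k)) (ϑ k)) U (𝓝 0)) :
    ∃ μ : ι → ℝ, (∀ i, 0 ≤ μ i) ∧
      ∀ i, Tendsto (fun k => sampleLoss h (ϑ k) i / lam k) U (𝓝 (μ i)) := by
  have hbound : ∀ᶠ k in U, (fun i => sampleLoss h (ϑ k) i / lam k) ∈
      Set.Icc (0 : ι → ℝ) fun _ => δ⁻¹ := by
    filter_upwards [hmargin, hres.norm.eventually_le_const (norm_zero.trans_lt zero_lt_one)]
      with k ⟨hne, hδk⟩ hk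
    have hnonneg : ∀ i, 0 ≤ sampleLoss h (ϑ k) i / lam k := fun i =>
      div_nonneg (sampleLoss_nonneg _ _ _) (hlam k).le
    refine ⟨hnonneg, fun i => ?_⟩
    rw [← one_div, le_div_iff₀ hδ]
    calc sampleLoss h (ϑ k) i / lam k * δ
        ≤ sampleLoss h (ϑ k) i / lam k * h i (‖ϑ k‖⁻¹ • ϑ k) :=
          mul_le_mul_of_nonneg_left (hδk i) (hnonneg i)
      _ ≤ ∑ j, sampleLoss h (ϑ k) j / lam k * h j (‖ϑ k‖⁻¹ • ϑ k) :=
          Finset.single_le_sum (f := fun j => sampleLoss h (ϑ k) j / lam k *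
            h j (‖ϑ k‖⁻¹ • ϑ k)) (fun j _ => mul_nonneg (hnonneg j) (hδ.le.trans (hδk j)))
            (Finset.mem_univ i)
      _ ≤ 1 := sum_sampleLoss_div_mul_le hh (hlam k).ne' hne hk
  obtain ⟨μ, hμ, hlim⟩ := isCompact_Icc.ultrafilter_le_nhds' (U.map _) hbound
  exact ⟨μ, hμ.1, tendsto_pi_nhds.1 hlim⟩

theorem eq_sum_smul_gradient_of_tendsto [l.NeBot] (hh : ∀ i, IsTwoHomogeneous (h i))
    {μ : ι → ℝ} (hlam : ∀ k, 0 < lam k) (hne : ∀ᶠ k in l, ϑ k ≠ 0)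
    (hres : Tendsto (fun k => (lam k * ‖ϑ k‖)⁻¹ • gradient (regExpLoss h (lam k)) (ϑ k)) l (𝓝 0))
    (hz : Tendsto (fun k => ‖ϑ k‖⁻¹ • ϑ k) l (𝓝 z))
    (hμ : ∀ i, Tendsto (fun k => sampleLoss h (ϑ k) i / lam k) l (𝓝 (μ i))) :
    z = ∑ i, μ i • gradient (h i) z := by
  refine sub_eq_zero.1 (tendsto_nhds_unique (hz.sub (tendsto_finsetSum _ fun i _ => (hμ i).smul
    (((hh i).continuous_gradient.tendsto z).comp hz))) (hres.congr' ?_))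
  filter_upwards [hne] with k hk
  exact inv_smul_gradient_regExpLoss hh (hlam k).ne' hk

theorem exists_isKKTPoint_of_mapClusterPt [Nonempty ι] (hh : ∀ i, IsTwoHomogeneous (h i))
    (hC : 0 < C) (hlam : ∀ k, 0 < lam k) (hlog : Tendsto (fun k => -Real.log (lam k)) l atTop)
    (hloss : ∀ᶠ k in l, regExpLoss h (lam k) (ϑ k) ≤ lam k * (C * -Real.log (lam k)))
    (hgrad : ∀ᶠ k in l, ‖gradient (regExpLoss h (lam k)) (ϑ k)‖ ≤ C * lam k)
    (hz : MapClusterPt z l fun k => ‖ϑ k‖⁻¹ • ϑ k) :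
    ∃ θstar, IsKKTPoint (fun ϑ : E => ‖ϑ‖ ^ 2) h θstar ∧ θstar ≠ 0 ∧ z = ‖θstar‖⁻¹ • θstar := by
  obtain ⟨U, hUl, hUz⟩ := mapClusterPt_iff_ultrafilter.1 hz
  obtain ⟨j, hj⟩ := Finite.exists_min fun i => h i z
  have hmargin := (eventually_pos_le_margin_direction hh hC hlam hlog hloss).filter_mono hUl
  have hne : ∀ᶠ k in U, ϑ k ≠ 0 := hmargin.mono fun _ hk => hk.1
  have hunit : ‖z‖ = 1 := tendsto_nhds_unique hUz.norm <| tendsto_const_nhds.congr' <|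
    hne.mono fun _ hk => (norm_smul_inv_norm (𝕜 := ℝ) hk).symm
  have hm : 0 < h j z := (by positivity : 0 < (4 * C)⁻¹).trans_le <|
    ge_of_tendsto (((hh j).contDiff.continuous.tendsto z).comp hUz) <|
      hmargin.mono fun _ hk => hk.2 j
  have hnorm : Tendsto (fun k => ‖ϑ k‖) U atTop :=
    (hh j).tendsto_norm_atTop (tendsto_atTop_mono' _
      (((eventually_neg_log_div_two_le hlam hlog hloss).filter_mono hUl).mono fun _ hk => hk j)
      ((hlog.mono_left hUl).atTop_div_const zero_lt_two)) hUz
  have hres := tendsto_inv_smul_gradient_regExpLoss hlam (hgrad.filter_mono hUl) hnorm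
  obtain ⟨μ, hμ0, hμ⟩ := exists_tendsto_sampleLoss_div hh hlam (by positivity) hmargin hres
  have hslack : ∀ i, μ i * (h i z - h j z) = 0 := fun i => by
    rcases (hj i).eq_or_lt with heq | hlt
    · rw [heq, sub_self, mul_zero]
    · rw [multiplier_eq_zero_of_lt hh hnorm hUz hμ hlt, zero_mul]
  have hsqrt := Real.sqrt_pos.2 hm
  refine ⟨(√(h j z))⁻¹ • z, isKKTPoint_inv_sqrt_smul hh hm hj hμ0 hslack
    (eq_sum_smul_gradient_of_tendsto hh hlam hne hres hUz hμ),
    smul_ne_zero (inv_ne_zero hsqrt.ne') (norm_ne_zero_iff.1 (hunit.trans_ne one_ne_zero)), ?_⟩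
  rw [norm_smul, hunit, mul_one, norm_inv, inv_inv, Real.norm_of_nonneg hsqrt.le,
    smul_inv_smul₀ hsqrt.ne']

end Limit

section DiagonalNet

variable {d n : ℕ} {x : Fin n → EuclideanSpace ℝ (Fin d)} {y : Fin n → ℝ}

/-- The margin of the `i`-th sample as a function of the parameters; these are the constraints of
the max-margin problem. -/
def margin (x : Fin n → EuclideanSpace ℝ (Fin d)) (y : Fin n → ℝ) (i : Fin n) (θ : Param d) : ℝ :=
  y i * net θ (x i)

/-- The negative gradient of the unregularized loss with respect to the effective weight. -/
def lossForce (x : Fin n → EuclideanSpace ℝ (Fin d)) (y : Fin n → ℝ) (θ : Param d) :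
    EuclideanSpace ℝ (Fin d) :=
  ∑ i, sampleLoss (margin x y) θ i • y i • x i

/-- The mirror coordinates `log u - log v`, paired with a reference direction `w`. -/
def mirrorPairing (w : EuclideanSpace ℝ (Fin d)) (θ : Param d) : ℝ :=
  ∑ k, w k * (Real.log (θ (Sum.inl k)) - Real.log (θ (Sum.inr k)))

theorem regLoss_eq_regExpLoss (lam : ℝ) : regLoss x y lam = regExpLoss (margin x y) lam := by
  funext θ
  simp only [regLoss, loss, regExpLoss, expLoss, sampleLoss, margin, Finset.mul_sum,
    Fintype.card_fin]

theorem norm_uPart_sq_add_norm_vPart_sq (θ : Param d) :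
    ‖uPart θ‖ ^ 2 + ‖vPart θ‖ ^ 2 = ‖θ‖ ^ 2 := by
  simp only [EuclideanSpace.norm_sq_eq, uPart, vPart, Fintype.sum_sum_type]

theorem norm_smul_initParam_sq (a : ℝ) : ‖a • initParam d‖ ^ 2 = 2 * d * a ^ 2 := by
  have hone : ‖initParam d‖ ^ 2 = 2 * d := by
    simp [EuclideanSpace.norm_sq_eq, initParam, two_mul]
  rw [norm_smul, mul_pow, hone, Real.norm_eq_abs, sq_abs, mul_comm]

theorem margin_smul_initParam (a : ℝ) (i : Fin n) : margin x y i (a • initParam d) = 0 := by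
  simp [margin, net, uPart, vPart, initParam]

theorem isTwoHomogeneous_margin (x : Fin n → EuclideanSpace ℝ (Fin d)) (y : Fin n → ℝ)
    (i : Fin n) : IsTwoHomogeneous (margin x y i) where
  contDiff := by
    unfold margin net uPart vPart
    fun_prop
  map_smul a θ := by
    simp only [margin, net, uPart, vPart, PiLp.smul_apply, smul_eq_mul, mul_pow, mul_assoc,
      ← Finset.mul_sum]
    ring

theorem hasGradientAt_net (X : EuclideanSpace ℝ (Fin d)) (θ : Param d) :
    HasGradientAt (fun ϑ : Param d => net ϑ X) (WithLp.toLp 2 (Sum.elim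
      (fun k => 2 * X k * θ (Sum.inl k)) fun k => -(2 * X k * θ (Sum.inr k)))) θ := by
  have hcoord : ∀ s : Fin d ⊕ Fin d, HasFDerivAt (fun ϑ : Param d => ϑ s)
      (EuclideanSpace.proj s : Param d →L[ℝ] ℝ) θ := fun s =>
    (EuclideanSpace.proj s : Param d →L[ℝ] ℝ).hasFDerivAt
  rw [hasGradientAt_iff_hasFDerivAt]
  refine ((HasFDerivAt.fun_sum fun k _ => ((hcoord (Sum.inl k)).pow 2).mul_const (X k)).sub
    (HasFDerivAt.fun_sum fun k _ => ((hcoord (Sum.inr k)).pow 2).mul_const (X k))).congr_fderiv ?_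
  ext ϑ
  simp only [InnerProductSpace.toDual_apply_apply, PiLp.inner_apply, Fintype.sum_sum_type,
    Sum.elim_inl, Sum.elim_inr, RCLike.inner_apply, conj_trivial]
  rw [sub_apply, sum_apply, sum_apply, sub_eq_add_neg, ← Finset.sum_neg_distrib]
  congr 1 <;> exact Finset.sum_congr rfl fun k _ => by simp; ring

theorem gradient_margin (i : Fin n) (θ : Param d) :
    gradient (margin x y i) θ = y i • WithLp.toLp 2 (Sum.elim
      (fun k => 2 * x i k * θ (Sum.inl k)) fun k => -(2 * x i k * θ (Sum.inr k))) := by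
  refine HasGradientAt.gradient ?_
  rw [hasGradientAt_iff_hasFDerivAt, map_smul]
  exact (hasGradientAt_net (x i) θ).hasFDerivAt.const_mul (y i)

theorem lossForce_apply (θ : Param d) (k : Fin d) :
    lossForce x y θ k = ∑ i, sampleLoss (margin x y) θ i * (y i * x i k) := by
  simp [lossForce]

theorem gradient_regLoss_inl (lam : ℝ) (θ : Param d) (k : Fin d) :
    gradient (regLoss x y lam) θ (Sum.inl k) =
      (lam - 2 * lossForce x y θ k) * θ (Sum.inl k) := by
  rw [regLoss_eq_regExpLoss, gradient_regExpLoss (isTwoHomogeneous_margin x y), lossForce_apply,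
    sub_mul, Finset.mul_sum, Finset.sum_mul]
  simp only [gradient_margin, PiLp.sub_apply, PiLp.smul_apply, smul_eq_mul, WithLp.ofLp_sum,
    Finset.sum_apply, Sum.elim_inl]
  congr 1
  exact Finset.sum_congr rfl fun i _ => by ring

theorem gradient_regLoss_inr (lam : ℝ) (θ : Param d) (k : Fin d) :
    gradient (regLoss x y lam) θ (Sum.inr k) =
      (lam + 2 * lossForce x y θ k) * θ (Sum.inr k) := by
  rw [regLoss_eq_regExpLoss, gradient_regExpLoss (isTwoHomogeneous_margin x y), lossForce_apply,
    add_mul, Finset.mul_sum, Finset.sum_mul, ← sub_neg_eq_add _ (∑ _, _), ← Finset.sum_neg_distrib]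
  simp only [gradient_margin, PiLp.sub_apply, PiLp.smul_apply, smul_eq_mul, WithLp.ofLp_sum,
    Finset.sum_apply, Sum.elim_inr]
  congr 1
  exact Finset.sum_congr rfl fun i _ => by ring

theorem mul_expLoss_le_inner_lossForce {γ : ℝ} {w : EuclideanSpace ℝ (Fin d)}
    (hγ : ∀ i, γ ≤ y i * inner ℝ w (x i)) (θ : Param d) :
    γ * expLoss (margin x y) θ ≤ inner ℝ w (lossForce x y θ) := by
  rw [lossForce, inner_sum, expLoss, Finset.mul_sum]
  refine Finset.sum_le_sum fun i _ => ?_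
  rw [real_inner_smul_right, real_inner_smul_right, mul_comm]
  exact mul_le_mul_of_nonneg_left (hγ i) (sampleLoss_nonneg _ _ _)

namespace IsGradientFlow

variable {lam α t : ℝ} {θ : ℝ → Param d}

theorem hasDerivWithinAt_apply {F : Param d → ℝ} {θ₀ : Param d} (hθ : IsGradientFlow F θ₀ θ)
    (ht : 0 ≤ t) (s : Fin d ⊕ Fin d) :
    HasDerivWithinAt (fun t => θ t s) (-gradient F (θ t) s) (Set.Ici 0) t :=
  (EuclideanSpace.proj s : Param d →L[ℝ] ℝ).hasFDerivAt.comp_hasDerivWithinAt t (hθ.2 t ht)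

theorem hasDerivWithinAt_inl {θ₀ : Param d} (hθ : IsGradientFlow (regLoss x y lam) θ₀ θ)
    (ht : 0 ≤ t) (k : Fin d) : HasDerivWithinAt (fun t => θ t (Sum.inl k))
      ((2 * lossForce x y (θ t) k - lam) * θ t (Sum.inl k)) (Set.Ici 0) t := by
  simpa only [gradient_regLoss_inl, ← neg_mul, neg_sub] using
    hθ.hasDerivWithinAt_apply ht (Sum.inl k)

theorem hasDerivWithinAt_inr {θ₀ : Param d} (hθ : IsGradientFlow (regLoss x y lam) θ₀ θ)
    (ht : 0 ≤ t) (k : Fin d) : HasDerivWithinAt (fun t => θ t (Sum.inr k))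
      (-(lam + 2 * lossForce x y (θ t) k) * θ t (Sum.inr k)) (Set.Ici 0) t := by
  simpa only [gradient_regLoss_inr, ← neg_mul] using hθ.hasDerivWithinAt_apply ht (Sum.inr k)

theorem apply_zero {F : Param d → ℝ} (hθ : IsGradientFlow F (α • initParam d) θ)
    (s : Fin d ⊕ Fin d) : θ 0 s = α := by
  simp [hθ.1, initParam]

theorem inl_mul_inr_mul_exp (hθ : IsGradientFlow (regLoss x y lam) (α • initParam d) θ)
    (ht : 0 ≤ t) (k : Fin d) :
    θ t (Sum.inl k) * θ t (Sum.inr k) * Real.exp (2 * lam * t) = α ^ 2 := by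
  have hderiv : ∀ t, 0 ≤ t → HasDerivWithinAt
      (fun t => θ t (Sum.inl k) * θ t (Sum.inr k) * Real.exp (2 * lam * t)) 0 (Set.Ici 0) t := by
    intro t ht
    refine (((hθ.hasDerivWithinAt_inl ht k).mul (hθ.hasDerivWithinAt_inr ht k)).mul
      ((hasDerivAt_id t).const_mul (2 * lam)).exp.hasDerivWithinAt).congr_deriv ?_
    simp only [Pi.mul_apply, id]
    ring
  have hconst := constant_of_has_deriv_right_zero
    (fun r hr => (hderiv r hr.1).continuousWithinAt.mono Set.Icc_subset_Ici_self)
    (fun r hr => (hderiv r hr.1).mono (Set.Ici_subset_Ici.2 hr.1)) t ⟨ht, le_rfl⟩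
  simpa only [hθ.apply_zero, mul_zero, Real.exp_zero, mul_one, ← sq] using hconst

theorem apply_pos (hθ : IsGradientFlow (regLoss x y lam) (α • initParam d) θ) (hα : 0 < α)
    (ht : 0 ≤ t) (s : Fin d ⊕ Fin d) : 0 < θ t s := by
  by_contra! hneg
  have hcont : ContinuousOn (fun t => θ t s) (Set.Icc 0 t) := fun r hr =>
    (hθ.hasDerivWithinAt_apply hr.1 s).continuousWithinAt.mono Set.Icc_subset_Ici_self
  obtain ⟨r, hr, hzero : θ r s = 0⟩ := intermediate_value_Icc' ht hcont
    ⟨hneg, hα.le.trans_eq (hθ.apply_zero s).symm⟩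
  have hα2 : α ^ 2 ≠ 0 := by positivity
  rcases s with k | k <;>
    exact hα2 (by rw [← hθ.inl_mul_inr_mul_exp hr.1 k, hzero]; ring)

theorem hasDerivWithinAt_mirrorPairing
    (hθ : IsGradientFlow (regLoss x y lam) (α • initParam d) θ) (hα : 0 < α)
    (w : EuclideanSpace ℝ (Fin d)) (ht : 0 ≤ t) :
    HasDerivWithinAt (fun t => mirrorPairing w (θ t)) (4 * inner ℝ w (lossForce x y (θ t)))
      (Set.Ici 0) t := by
  refine (HasDerivWithinAt.fun_sum fun k _ =>
    (((hθ.hasDerivWithinAt_inl ht k).log (hθ.apply_pos hα ht _).ne').sub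
      ((hθ.hasDerivWithinAt_inr ht k).log (hθ.apply_pos hα ht _).ne')).const_mul
        (w k)).congr_deriv ?_
  rw [PiLp.inner_apply, Finset.mul_sum]
  refine Finset.sum_congr rfl fun k _ => ?_
  rw [mul_div_cancel_right₀ _ (hθ.apply_pos hα ht _).ne',
    mul_div_cancel_right₀ _ (hθ.apply_pos hα ht _).ne', RCLike.inner_apply, conj_trivial]
  ring

theorem mirrorPairing_zero {F : Param d → ℝ} (hθ : IsGradientFlow F (α • initParam d) θ)
    (w : EuclideanSpace ℝ (Fin d)) : mirrorPairing w (θ 0) = 0 := by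
  simp [mirrorPairing, hθ.apply_zero]

theorem norm_sq_le_div (hθ : IsGradientFlow (regLoss x y lam) (α • initParam d) θ) (hα : 1 ≤ α)
    (hlam : 0 < lam) (hlam1 : lam ≤ 1) (ht : 0 ≤ t) :
    ‖θ t‖ ^ 2 ≤ (2 * d + 2) * α ^ 2 / lam := by
  rw [regLoss_eq_regExpLoss] at hθ
  have henergy := hθ.antitoneOn_objective
    (differentiable_regExpLoss (isTwoHomogeneous_margin x y) lam) Set.self_mem_Ici ht ht
  simp only [hθ.1, regExpLoss, norm_smul_initParam_sq] at henergy
  have hinit : expLoss (margin x y) (α • initParam d) ≤ 1 :=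
    expLoss_le_one fun i => (margin_smul_initParam α i).ge
  have hα2 : 1 ≤ α ^ 2 := one_le_pow₀ hα
  have hdecay : lam * (d * α ^ 2) ≤ d * α ^ 2 := mul_le_of_le_one_left (by positivity) hlam1
  rw [le_div_iff₀ hlam]
  linarith [expLoss_nonneg (margin x y) (θ t)]

theorem abs_log_inl_sub_log_inr_le (hθ : IsGradientFlow (regLoss x y lam) (α • initParam d) θ)
    (hα : 0 < α) (ht : 0 ≤ t) {B : ℝ} (hB : ‖θ t‖ ^ 2 ≤ B) (k : Fin d) :
    |Real.log (θ t (Sum.inl k)) - Real.log (θ t (Sum.inr k))| ≤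
      Real.log B + 2 * lam * t - 2 * Real.log α := by
  have hle : ∀ s, 2 * Real.log (θ t s) ≤ Real.log B := fun s => by
    have hpos := hθ.apply_pos hα ht s
    rw [← Nat.cast_ofNat, ← Real.log_pow]
    refine Real.log_le_log (by positivity) (le_trans ?_ hB)
    rw [← Real.norm_of_nonneg hpos.le]
    exact pow_le_pow_left₀ (norm_nonneg _) (PiLp.norm_apply_le (θ t) s) 2
  have hu := hθ.apply_pos hα ht (Sum.inl k)
  have hv := hθ.apply_pos hα ht (Sum.inr k)
  have hsum : Real.log (θ t (Sum.inl k)) + Real.log (θ t (Sum.inr k)) + 2 * lam * t =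
      2 * Real.log α := by
    rw [← Real.log_mul hu.ne' hv.ne', ← Real.log_exp (2 * lam * t),
      ← Real.log_mul (mul_pos hu hv).ne' (Real.exp_pos _).ne', hθ.inl_mul_inr_mul_exp ht,
      Real.log_pow, Nat.cast_ofNat]
  rw [abs_le]
  constructor <;> linarith [hle (Sum.inl k), hle (Sum.inr k)]

theorem mirrorPairing_le (hθ : IsGradientFlow (regLoss x y lam) (α • initParam d) θ)
    (hα : 1 ≤ α) (hlam : 0 < lam) (hlam1 : lam ≤ 1) (w : EuclideanSpace ℝ (Fin d)) (ht : 0 ≤ t) :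
    mirrorPairing w (θ t) ≤
      (∑ k, |w k|) * (Real.log (2 * d + 2) - Real.log lam + 2 * lam * t) := by
  have hα0 : 0 < α := zero_lt_one.trans_le hα
  have hlog : Real.log ((2 * d + 2) * α ^ 2 / lam) =
      Real.log (2 * d + 2) + 2 * Real.log α - Real.log lam := by
    rw [Real.log_div (by positivity) hlam.ne', Real.log_mul (by positivity) (by positivity),
      Real.log_pow, Nat.cast_ofNat]
  rw [mirrorPairing, Finset.sum_mul]
  refine Finset.sum_le_sum fun k _ => (le_abs_self _).trans ?_
  rw [abs_mul]
  gcongr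
  linarith [hθ.abs_log_inl_sub_log_inr_le hα0 ht (hθ.norm_sq_le_div hα hlam hlam1 ht) k]

end IsGradientFlow

end DiagonalNet

section MaxMargin

variable {d n : ℕ} {x : Fin n → EuclideanSpace ℝ (Fin d)} {y : Fin n → ℝ}

-- The hypothesis `hM` of `IsGradientFlow.exists_near_stationary` for `K = -log lam`, `l = log α`,
-- `D` half the damped initial squared norm and `m` the mirror potential at the end of the window.
theorem near_stationary_budget_le {lam β γ c D K l S m A : ℝ} (hD : 0 ≤ D) (hlam : 0 < lam)
    (hK : 1 ≤ K) (hKl : K ≤ β * l) (hβ : 0 < β) (hγ : 0 < γ) (hc : 0 < c)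
    (hm : m ≤ S * l) (hA : D * β + S / γ + 2 ≤ A) :
    2 * K * lam + (D + 4 * K * (m / (4 * γ)) + 2 * (K * lam) * (l / lam)) / (c / 2 * l / lam) ≤
      2 * (lam * ((1 + A / c) * K)) := by
  have hl : 0 < l := pos_of_mul_pos_right (zero_lt_one.trans_le (hK.trans hKl)) hβ.le
  have hKlβ : 1 ≤ K * (β * l) := one_le_mul_of_one_le_of_one_le hK (hK.trans hKl)
  have hnum : D + 4 * K * (m / (4 * γ)) + 2 * (K * lam) * (l / lam) ≤ A * (K * l) := by
    calc D + 4 * K * (m / (4 * γ)) + 2 * (K * lam) * (l / lam)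
        = D * 1 + K * (m / γ) + 2 * (K * l) := by field_simp
      _ ≤ D * (K * (β * l)) + K * (S * l / γ) + 2 * (K * l) := by gcongr
      _ = (D * β + S / γ + 2) * (K * l) := by ring
      _ ≤ A * (K * l) := by gcongr
  calc 2 * K * lam + (D + 4 * K * (m / (4 * γ)) + 2 * (K * lam) * (l / lam)) / (c / 2 * l / lam)
      ≤ 2 * K * lam + A * (K * l) / (c / 2 * l / lam) := by gcongr
    _ = 2 * (lam * ((1 + A / c) * K)) := by field_simp

namespace IsGradientFlow

variable {lam α β γ c : ℝ} {θ : ℝ → Param d} {w : EuclideanSpace ℝ (Fin d)}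

theorem mirrorPairing_le_mul_log (hθ : IsGradientFlow (regLoss x y lam) (α • initParam d) θ)
    (hα : 1 ≤ α) (hlam : 0 < lam) (hlog : 1 ≤ -Real.log lam)
    (hlogα : -Real.log lam ≤ β * Real.log α) (hc : 0 ≤ c) (w : EuclideanSpace ℝ (Fin d)) :
    mirrorPairing w (θ (c * Real.log α / lam)) ≤
      (∑ k, |w k|) * ((Real.log (2 * d + 2) + 1) * β + 2 * c) * Real.log α := by
  have hl : 0 ≤ Real.log α := Real.log_nonneg hα
  have hlam1 : lam ≤ 1 := ((Real.log_neg_iff hlam).1 (by linarith)).le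
  have hd : 0 ≤ Real.log (2 * d + 2) :=
    Real.log_nonneg (by linarith [(Nat.cast_nonneg d : (0 : ℝ) ≤ d)])
  refine (hθ.mirrorPairing_le hα hlam hlam1 w (by positivity)).trans ?_
  rw [mul_assoc (∑ k, |w k|), mul_assoc 2, mul_div_cancel₀ _ hlam.ne']
  gcongr
  linarith [mul_le_mul_of_nonneg_left (hlog.trans hlogα) hd]

theorem exists_near_stationary_mul_log (hθ : IsGradientFlow (regLoss x y lam) (α • initParam d) θ)
    (hα : 1 ≤ α) (hlam : 0 < lam) (hlog : 1 ≤ -Real.log lam)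
    (hlogα : -Real.log lam ≤ β * Real.log α) (hβ : 0 < β) (hγ : 0 < γ)
    (hw : ∀ i, γ ≤ y i * inner ℝ w (x i)) (hc : 0 < c) {A : ℝ} (hA0 : 0 ≤ A)
    (hA : d * β + (∑ k, |w k|) * ((Real.log (2 * d + 2) + 1) * β + 2 * (1 + c / 2)) / γ + 2 ≤ A) :
    ∃ t ∈ Set.Icc (Real.log α / lam) ((1 + c) * Real.log α / lam),
      regLoss x y lam (θ t) ≤ lam * ((1 + A / c) * -Real.log lam) ∧
      ‖gradient (regLoss x y lam) (θ t)‖ ^ 2 ≤ (1 + A / c) * (2 * β / c) * lam ^ 2 := by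
  have hl : 0 < Real.log α := by nlinarith
  have hcancel : ∀ r, lam * (r / lam) = r := fun r => mul_div_cancel₀ r hlam.ne'
  have hexp : Real.exp (-(-Real.log lam)) = lam := by rw [neg_neg, Real.exp_log hlam]
  have hinit : Real.exp (-(2 * lam * (Real.log α / lam))) * ‖α • initParam d‖ ^ 2 / 2 = d := by
    have : α ^ 2 ≠ 0 := by positivity
    rw [norm_smul_initParam_sq, mul_assoc, hcancel, ← Nat.cast_ofNat, ← Real.log_pow, Real.exp_neg,
      Real.exp_log (by positivity)]
    field_simp
  have hφ := hθ.mirrorPairing_le_mul_log hα hlam hlog hlogα (by positivity : 0 ≤ 1 + c / 2) w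
  have hflow := hθ
  rw [regLoss_eq_regExpLoss] at hflow ⊢
  have hfirst : (1 + c / 2) * Real.log α / lam - Real.log α / lam = c / 2 * Real.log α / lam := by
    ring
  have hsecond : (1 + c) * Real.log α / lam - (1 + c / 2) * Real.log α / lam =
      c / 2 * Real.log α / lam := by ring
  have hgap : 0 < c / 2 * Real.log α / lam := by positivity
  obtain ⟨t, ht, hloss, hgrad⟩ := hflow.exists_near_stationary (isTwoHomogeneous_margin x y)
    hlam.le hlog (φ := fun t => mirrorPairing w (θ t) / (4 * γ))
    (fun t ht => (hθ.hasDerivWithinAt_mirrorPairing (by linarith) w ht).div_const (4 * γ))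
    (fun t _ => by
      rw [mul_div_mul_left _ _ four_ne_zero, le_div_iff₀' hγ]
      exact mul_expLoss_le_inner_lossForce hw (θ t))
    (by positivity) (sub_pos.1 (hgap.trans_eq hfirst.symm))
    (sub_pos.1 (hgap.trans_eq hsecond.symm)) (by
      simp only [hexp, hinit, hfirst, hθ.mirrorPairing_zero, zero_div, sub_zero]
      exact near_stationary_budget_le d.cast_nonneg hlam hlog hlogα hβ hγ hc hφ hA)
  refine ⟨t, ht, hloss, hgrad.trans ?_⟩
  rw [hsecond, div_le_iff₀ hgap]
  calc lam * ((1 + A / c) * -Real.log lam) ≤ lam * ((1 + A / c) * (β * Real.log α)) := by gcongr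
    _ = (1 + A / c) * (2 * β / c) * lam ^ 2 * (c / 2 * Real.log α / lam) := by field_simp

end IsGradientFlow

theorem exists_const_near_stationary {β γ c : ℝ} {w : EuclideanSpace ℝ (Fin d)} (hβ : 0 < β)
    (hγ : 0 < γ) (hw : ∀ i, γ ≤ y i * inner ℝ w (x i)) (hc : 0 < c) :
    ∃ C, 0 < C ∧ ∀ {lam α : ℝ} {θ : ℝ → Param d},
      IsGradientFlow (regLoss x y lam) (α • initParam d) θ → 1 ≤ α → 0 < lam →
      1 ≤ -Real.log lam → -Real.log lam ≤ β * Real.log α →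
      ∃ t ∈ Set.Icc (Real.log α / lam) ((1 + c) * Real.log α / lam),
        regLoss x y lam (θ t) ≤ lam * (C * -Real.log lam) ∧
        ‖gradient (regLoss x y lam) (θ t)‖ ≤ C * lam := by
  set A : ℝ := max 0
    (d * β + (∑ k, |w k|) * ((Real.log (2 * d + 2) + 1) * β + 2 * (1 + c / 2)) / γ + 2)
  have hA0 : 0 ≤ A := le_max_left _ _
  have hA1 : 1 ≤ 1 + A / c := le_add_of_nonneg_right (by positivity)
  have hβ1 : 1 ≤ 1 + 2 * β / c := le_add_of_nonneg_right (by positivity)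
  have hC : 1 ≤ (1 + A / c) * (1 + 2 * β / c) := one_le_mul_of_one_le_of_one_le hA1 hβ1
  refine ⟨(1 + A / c) * (1 + 2 * β / c), by positivity,
    fun {lam α θ} hθ hα hlam hlog hlogα => ?_⟩
  obtain ⟨t, ht, hloss, hgrad⟩ := hθ.exists_near_stationary_mul_log hα hlam hlog hlogα hβ hγ hw hc
    hA0 (le_max_right _ _)
  refine ⟨t, ht, hloss.trans ?_, ?_⟩
  · gcongr
    exact le_mul_of_one_le_right (by positivity) hβ1
  · refine le_of_sq_le_sq (hgrad.trans ?_) (by positivity)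
    rw [mul_pow]
    gcongr
    refine le_trans ?_ (le_self_pow₀ hC two_ne_zero)
    gcongr
    linarith

theorem isKKTPoint_margin_iff {θstar : Param d} :
    IsKKTPoint (fun ϑ : Param d => ‖ϑ‖ ^ 2) (margin x y) θstar ↔
      IsKKTPoint (fun ϑ : Param d => ‖uPart ϑ‖ ^ 2 + ‖vPart ϑ‖ ^ 2)
        (fun i ϑ => y i * inner ℝ (effWeight ϑ) (x i)) θstar := by
  simp only [norm_uPart_sq_add_norm_vPart_sq, ← net_eq_inner]
  rfl

end MaxMargin

end DiagNet

end

theorem mainTheorem9_general {d n : ℕ} (hn : 0 < n)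
    (x : Fin n → EuclideanSpace ℝ (Fin d)) (y : Fin n → ℝ)
    (wstar : EuclideanSpace ℝ (Fin d)) (hwstar : ∀ i, 0 < y i * inner ℝ wstar (x i))
    (lam α : ℕ → ℝ) (hlam_pos : ∀ k, 0 < lam k) (hlam : Tendsto lam atTop (𝓝 0))
    (hα : ∀ k, 1 ≤ α k) (hlog : (fun k => Real.log (lam k)) =O[atTop] fun k => Real.log (α k))
    (c : ℝ) (hc : 0 < c) (θ : ℕ → ℝ → DiagNet.Param d)
    (hθ : ∀ k, DiagNet.IsGradientFlow (DiagNet.regLoss x y (lam k))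
      (α k • DiagNet.initParam d) (θ k)) :
    ∃ t : ℕ → ℝ,
      (∀ k, 1 / lam k * Real.log (α k) ≤ t k ∧ t k ≤ (1 + c) / lam k * Real.log (α k)) ∧
      ∀ z : DiagNet.Param d,
        MapClusterPt z atTop (fun k => ‖θ k (t k)‖⁻¹ • θ k (t k)) →
        ∃ θstar : DiagNet.Param d,
          DiagNet.IsKKTPoint
            (fun ϑ : DiagNet.Param d => ‖DiagNet.uPart ϑ‖ ^ 2 + ‖DiagNet.vPart ϑ‖ ^ 2)
            (fun (i : Fin n) (ϑ : DiagNet.Param d) =>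
              y i * inner ℝ (DiagNet.effWeight ϑ) (x i)) θstar ∧
          θstar ≠ 0 ∧ z = ‖θstar‖⁻¹ • θstar := by
  have : Nonempty (Fin n) := ⟨⟨0, hn⟩⟩
  obtain ⟨j, hj⟩ := Finite.exists_min fun i => y i * inner ℝ wstar (x i)
  obtain ⟨β, hβ, hbound⟩ := hlog.exists_pos
  obtain ⟨C, hC, hnear⟩ := DiagNet.exists_const_near_stationary hβ (hwstar j) hj hc
  have hlam_log := DiagNet.tendsto_neg_log_atTop hlam_pos hlam
  have hlogα := fun k => Real.log_nonneg (hα k)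
  have hwindow : ∀ k, Real.log (α k) / lam k ≤ (1 + c) * Real.log (α k) / lam k := fun k =>
    div_le_div_of_nonneg_right
      (le_mul_of_one_le_left (hlogα k) (le_add_of_nonneg_right hc.le)) (hlam_pos k).le
  obtain ⟨t, ht, hlim⟩ := DiagNet.exists_seq_of_eventually
    (fun k => ⟨_, Set.left_mem_Icc.2 (hwindow k)⟩) <| by
      filter_upwards [hbound.bound, hlam_log.eventually_ge_atTop 1] with k hk hk1
      rw [Real.norm_of_nonneg (hlogα k)] at hk
      exact hnear (hθ k) (hα k) (hlam_pos k) hk1 ((neg_le_abs _).trans hk)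
  refine ⟨t, fun k => ?_, fun z hz => ?_⟩
  · simpa only [Set.mem_Icc, div_mul_eq_mul_div, one_mul] using ht k
  · simp only [DiagNet.regLoss_eq_regExpLoss] at hlim
    obtain ⟨θstar, hKKT, hne, hzθ⟩ := DiagNet.exists_isKKTPoint_of_mapClusterPt
      (DiagNet.isTwoHomogeneous_margin x y) hC hlam_pos hlam_log
      (hlim.mono fun _ hk => hk.1) (hlim.mono fun _ hk => hk.2) hz
    exact ⟨θstar, DiagNet.isKKTPoint_margin_iff.1 hKKT, hne, hzθ⟩

theorem mainTheorem9 {d n : ℕ} (hn : 0 < n)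
    (x : Fin n → EuclideanSpace ℝ (Fin d)) (y : Fin n → ℝ)
    (hy : ∀ i, y i = 1 ∨ y i = -1)
    (wstar : EuclideanSpace ℝ (Fin d)) (hwstar : ∀ i, y i = Real.sign (inner ℝ wstar (x i)))
    (lam : ℝ → ℝ) (hlam_pos : ∀ a, 0 < a → 0 < lam a)
    (p : ℝ) (hp : 0 < p) (hlam : lam =Θ[atTop] fun a : ℝ => a ^ (-p))
    (c : ℝ) (hc0 : 0 < c) (hc1 : c < 1)
    (α : ℕ → ℝ) (hα1 : ∀ k, 1 ≤ α k) (hα : Tendsto α atTop atTop)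
    (θ : ℕ → ℝ → DiagNet.Param d)
    (hθ : ∀ k, DiagNet.IsGradientFlow (DiagNet.regLoss x y (lam (α k)))
      (α k • DiagNet.initParam d) (θ k)) :
    ∃ t : ℕ → ℝ,
      (∀ k, 1 / lam (α k) * Real.log (α k) ≤ t k ∧
        t k ≤ (1 + c) / lam (α k) * Real.log (α k)) ∧
      ∀ z : DiagNet.Param d,
        MapClusterPt z atTop (fun k => ‖θ k (t k)‖⁻¹ • θ k (t k)) →
        ∃ θstar : DiagNet.Param d,
          DiagNet.IsKKTPoint
            (fun ϑ : DiagNet.Param d => ‖DiagNet.uPart ϑ‖ ^ 2 + ‖DiagNet.vPart ϑ‖ ^ 2)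
            (fun (i : Fin n) (ϑ : DiagNet.Param d) =>
              y i * inner ℝ (DiagNet.effWeight ϑ) (x i)) θstar ∧
          θstar ≠ 0 ∧ z = ‖θstar‖⁻¹ • θstar :=
  mainTheorem9_general hn x y wstar (fun i => DiagNet.mul_pos_of_eq_sign (hy i) (hwstar i))
    (fun k => lam (α k)) α (fun k => hlam_pos _ (zero_lt_one.trans_le (hα1 k)))
    ((hlam.1.trans_tendsto (tendsto_rpow_neg_atTop hp)).comp hα) hα1
    ((DiagNet.isBigO_log_of_isTheta_rpow hlam_pos hlam).comp_tendsto hα) c hc0 θ hθ
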